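/- Let $n\ge 1$, let $\varepsilon_1,\dots,\varepsilon_n$ be the standard basis of the Euclidean space $\mathbb R^n$, and let $\Delta$ be either the root system of type $B_n$, $$\Delta=\{\pm(\varepsilon_i\pm\varepsilon_j)\mid 1\le i<j\le n\}\cup\{\pm\varepsilon_i\mid 1\le i\le n\},$$ or the root system of type $C_n$, $$\Delta=\{\pm(\varepsilon_i\pm\varepsilon_j)\mid 1\le i<j\le n\}\cup\{\pm2\varepsilon_i\mid 1\le i\le n\}.$$ Let $W$ be the Weyl group of $\Delta$ (the hyperoctahedral group), i.e. the group generated by the reflections $s_\alpha$, $\alpha\in\Delta$. Fix a positive system $\Delta^+\subset\Delta$, i.e. $\Delta^+=\{\alpha\in\Delta\mid(\gamma,\alpha)>0\}$ for some $\gamma\in\mathbb R^n$ orthogonal to no root. For $w\in W$ put $N(w)=\{\alpha\in\Delta^+\mid w^{-1}(\alpha)\in-\Delta^+\}$. A subset $Y\subseteq W$ is called inversion complete if $\bigcup_{w\in Y}N(w)=\Delta^+$, and minimal inversion complete if it is inversion complete and no proper subset of it is inversion complete. Then the maximal cardinality of a minimal inversion complete subset of $W$ is $$MC(B_n)=MC(C_n)=\binom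 n2+1 .$$ -/

import Mathlib

open scoped Pointwise

noncomputable section

namespace MinInvComplete

section General

variable {V : Type*} [NormedAddCommGroup V] [InnerProductSpace ℝ V]

/-- The Weyl group of a set `Φ` of roots in a Euclidean space: the group of isometries generated by
the reflections `s_α`, `α ∈ Φ`, in the hyperplanes orthogonal to the roots. -/
def weylGroup (Φ : Set V) : Subgroup (V ≃ₗᵢ[ℝ] V) :=
  Subgroup.closure {s | ∃ α ∈ Φ, s = (ℝ ∙ α)ᗮ.reflection}

/-- `P` is a positive system of `Φ`: the set of roots lying strictly on the positive side of a
hyperplane through the origin that contains no root. -/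
def IsPositiveSystem (Φ P : Set V) : Prop :=
  ∃ γ : V, (∀ α ∈ Φ, inner ℝ γ α ≠ 0) ∧ P = {α ∈ Φ | 0 < inner ℝ γ α}

/-- The inversion set `N(w) = {α ∈ P | w⁻¹(α) ∈ -P}` with respect to the positive system `P`. -/
def inversionSet (P : Set V) (w : V ≃ₗᵢ[ℝ] V) : Set V :=
  {α ∈ P | w⁻¹ α ∈ -P}

/-- `Y ⊆ W` is inversion complete if the inversion sets of its elements cover `P`. -/
def IsInversionComplete (Φ P : Set V) (Y : Set (weylGroup Φ)) : Prop :=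
  ⋃ w ∈ Y, inversionSet P (w : V ≃ₗᵢ[ℝ] V) = P

/-- `Y` is inversion complete, and minimal under inclusion among inversion complete subsets
of `W`. -/
def IsMinimalInversionComplete (Φ P : Set V) (Y : Set (weylGroup Φ)) : Prop :=
  Minimal (IsInversionComplete Φ P) Y

/-- `m` is the maximal cardinality `MC` of a minimal inversion complete subset of the Weyl group
of `Φ`, with respect to the positive system `P`. -/
def IsMC (Φ P : Set V) (m : ℕ) : Prop :=
  IsGreatest {k : ℕ∞ | ∃ Y : Set (weylGroup Φ),
    IsMinimalInversionComplete Φ P Y ∧ Y.encard = k} (m : ℕ∞)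

end General

/-- The standard basis vector `ε_i` of `ℝⁿ`. -/
def e {n : ℕ} (i : Fin n) : EuclideanSpace ℝ (Fin n) := EuclideanSpace.single i 1

/-- The roots `±(ε_i ± ε_j)`, `i < j`. -/
def rootsD (n : ℕ) : Set (EuclideanSpace ℝ (Fin n)) :=
  {α | ∃ i j : Fin n, i < j ∧
    (α = e i + e j ∨ α = e i - e j ∨ α = -(e i + e j) ∨ α = -(e i - e j))}

/-- The root system of type `B_n`: the vectors `±(ε_i ± ε_j)`, `i < j`, and `±ε_i`. -/
def rootsB (n : ℕ) : Set (EuclideanSpace ℝ (Fin n)) :=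
  rootsD n ∪ {α | ∃ i : Fin n, α = e i ∨ α = -e i}

/-- The root system of type `C_n`: the vectors `±(ε_i ± ε_j)`, `i < j`, and `±2ε_i`. -/
def rootsC (n : ℕ) : Set (EuclideanSpace ℝ (Fin n)) :=
  rootsD n ∪ {α | ∃ i : Fin n, α = (2 : ℝ) • e i ∨ α = -((2 : ℝ) • e i)}

end MinInvComplete

end

/-! Choose signs and an order of the basis vectors to get `u` with 0 < (γ, u_0) < (γ, u_1) < ...
(`Adapted`). The positive roots are then k u_i and u_j ± u_i for i < j (k = 1 for B, k = 2 for C),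
and N(w) consists of those on which wγ is negative. A complete set is minimal iff each member has a
private root, one inverted by no other member.

Upper bound (`exists_injective_of_private`): send a member with private root u_j ± u_i to the pair
(j, i), and one with private root u_i to the index i. If both roots of a pair are private, the
member owning u_j - u_i goes to the index j instead. Each used index i carries a certificate: a
member negative at i must own u_i, or one of the two roots of a single pair with top index i. Some
member is negative at i, so the map is injective; certificates also show that no pair of used
indices is itself a value. With M the largest used index, the other used indices i move to the free
pairs (M, i), and only M needs an extra value (`exists_injective_option`).

Lower bound: for each pair take a member with private root u_j + u_i (`exists_weyl_pair`), and add
the sign change of u_0 (`exists_weyl_zero`). -/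

namespace MinInvComplete

/-! ### Upper bound for families of functionals with private roots -/

section Combinatorics

/-- Pairs `(j, i)` of indices with `i < j`. -/
abbrev Pairs (n : ℕ) : Type := {p : Fin n × Fin n // p.2 < p.1}

/-- Labels of the positive roots: `u_i` (up to scaling), `u_j + u_i` and `u_j - u_i` for `i < j`. -/
inductive PosRoot (n : ℕ) : Type
  | short (i : Fin n)
  | plus (p : Pairs n)
  | minus (p : Pairs n)

/-- The value of a linear functional with coordinates `y` on a positive root. -/
def PosRoot.val {n : ℕ} (y : Fin n → ℝ) : PosRoot n → ℝ
  | .short i => y i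
  | .plus p => y p.1.1 + y p.1.2
  | .minus p => y p.1.1 - y p.1.2

theorem card_pairs (n : ℕ) : Fintype.card (Pairs n) = n.choose 2 := by
  have h : Fintype.card (Pairs n) = Fintype.card (Σ j : Fin n, {i : Fin n // i < j}) :=
    Fintype.card_congr
      { toFun := fun p => ⟨p.1.1, p.1.2, p.2⟩
        invFun := fun q => ⟨(q.1, q.2.1), q.2.2⟩
        left_inv := fun _ => rfl
        right_inv := fun _ => rfl }
  have h' : ∀ j : Fin n, Fintype.card {i : Fin n // i < j} = j := fun j => by
    rw [Fintype.card_subtype, ← Fin.card_Iio j]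
    congr 1
    ext i
    simp
  rw [h, Fintype.card_sigma, Finset.sum_congr rfl fun j _ => h' j,
    Fin.sum_univ_eq_sum_range (fun j => j), Finset.sum_range_id, Nat.choose_two_right]

/-- If the indices `i` occurring as `inr i` are such that no pair of two of them occurs as `inl`,
then an injection into the disjoint sum can be improved to one into `Option (Pairs n)`. -/
theorem exists_injective_option {n : ℕ} {ι : Type*} {φ : ι → Pairs n ⊕ Fin n}
    (hφ : Function.Injective φ)
    (h : ∀ w w' v (p : Pairs n), φ w = .inr p.1.1 → φ w' = .inr p.1.2 → φ v ≠ .inl p) :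
    ∃ ψ : ι → Option (Pairs n), Function.Injective ψ := by
  classical
  by_cases hT : ∃ i, ∃ w, φ w = .inr i
  · obtain ⟨M, ⟨wM, hwM⟩, hM⟩ := Set.exists_max_image {i | ∃ w, φ w = .inr i} id
      (Set.toFinite _) hT
    have hlt : ∀ {w i}, φ w = .inr i → i ≠ M → i < M :=
      fun {w i} hw hi => lt_of_le_of_ne (hM i ⟨w, hw⟩) hi
    -- By `h`, the pair `(M, i)` is not a value of `φ` when both `M` and `i` are; `M` itself takes
    -- `none`.
    let θ : Pairs n ⊕ Fin n → Option (Pairs n) := fun x => match x with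
      | .inl p => some p
      | .inr i => if hi : i < M then some ⟨(M, i), hi⟩ else none
    refine ⟨fun w => θ (φ w), fun w w' hww => hφ ?_⟩
    rcases hw : φ w with p | i <;> rcases hw' : φ w' with q | j <;>
      simp only [hw, hw', θ] at hww
    · simpa using hww
    · by_cases hj : j < M
      · simp only [hj, dite_true, Option.some.injEq] at hww
        exact absurd (hww ▸ hw) (h wM w' w ⟨(M, j), hj⟩ hwM hw')
      · simp [hj] at hww
    · by_cases hi : i < M
      · simp only [hi, dite_true, Option.some.injEq] at hww
        exact absurd (hww ▸ hw') (h wM w w' ⟨(M, i), hi⟩ hwM hw)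
      · simp [hi] at hww
    · by_cases hi : i < M <;> by_cases hj : j < M <;> simp [hi, hj] at hww
      · rw [hww]
      · have hi' : i = M := by_contra fun hne => hi (hlt hw hne)
        have hj' : j = M := by_contra fun hne => hj (hlt hw' hne)
        rw [hi', hj']
  · push Not at hT
    have : ∀ w, ∃ p, φ w = .inl p := fun w => by
      rcases hw : φ w with p | i
      · exact ⟨p, rfl⟩
      · exact absurd hw (hT i w)
    choose f hf using this
    refine ⟨fun w => some (f w), fun w w' hww => hφ ?_⟩
    rw [hf, hf, Option.some.inj hww]

/-- A family of functionals, each negative on a private root and positive on the private roots of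
the others, whose negative sets cover all coordinates, embeds into `Option (Pairs n)`. -/
theorem exists_injective_of_private {n : ℕ} {ι : Type*} (F : ι → Fin n → ℝ) (r : ι → PosRoot n)
    (hneg : ∀ w, (r w).val (F w) < 0) (hpos : ∀ w v, w ≠ v → 0 < (r v).val (F w))
    (hcov : ∀ i, ∃ w, F w i < 0) :
    ∃ ψ : ι → Option (Pairs n), Function.Injective ψ := by
  classical
  have hr : Function.Injective r := fun w v hwv => by
    by_contra hne
    have h1 := hpos w v hne
    have h2 := hneg w
    rw [hwv] at h2
    linarith
  have hpos' : ∀ w v ρ, r v = ρ → ρ ≠ r w → 0 < ρ.val (F w) := fun w v ρ hv hne => by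
    subst hv
    exact hpos w v fun h => hne (h ▸ rfl)
  -- Two certificates of positivity of the `i`-th coordinate.
  have hshort : ∀ v i, r v = .short i → ∀ w, F w i < 0 → r w = .short i := fun v i hv w hw => by
    by_contra hne
    have := hpos' w v _ hv fun h => hne h.symm
    simp only [PosRoot.val] at this
    linarith
  -- The two roots of `p` sum to twice the top coordinate, so they cannot both be positive where it
  -- is negative.
  have hdouble : ∀ a b p, r a = .plus p → r b = .minus p → ∀ w, F w p.1.1 < 0 →
      r w = .plus p ∨ r w = .minus p := fun a b p ha hb w hw => by
    by_contra! hne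
    have h1 := hpos' w a _ ha fun h => hne.1 h.symm
    have h2 := hpos' w b _ hb fun h => hne.2 h.symm
    simp only [PosRoot.val] at h1 h2
    linarith
  let φ : ι → Pairs n ⊕ Fin n := fun w => match r w with
    | .short i => .inr i
    | .plus p => .inl p
    | .minus p => if ∃ v, r v = .plus p then .inr p.1.1 else .inl p
  have hinl : ∀ w p, φ w = .inl p →
      r w = .plus p ∨ (r w = .minus p ∧ ∀ v, r v ≠ .plus p) := fun w p hw => by
    rcases h : r w with i | q | q <;> simp only [φ, h] at hw
    · simp at hw
    · left; simpa using hw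
    · split_ifs at hw with h'
      push Not at h'
      obtain rfl : q = p := by simpa using hw
      exact .inr ⟨rfl, h'⟩
  have hinr : ∀ w i, φ w = .inr i →
      r w = .short i ∨ ∃ p a, p.1.1 = i ∧ r w = .minus p ∧ r a = .plus p := fun w i hw => by
    rcases h : r w with j | q | q <;> simp only [φ, h] at hw
    · left; simpa using hw
    · simp at hw
    · split_ifs at hw with h'
      obtain ⟨a, ha⟩ := h'
      exact .inr ⟨q, a, by simpa using hw, rfl, ha⟩
  -- A functional negative at `i` obeys every certificate for `i`, so two certificates cannot name
  -- disjoint sets of roots.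
  have huniq : ∀ w v i, φ w = .inr i → φ v = .inr i → w = v := fun w v i hw hv => by
    obtain ⟨x, hx⟩ := hcov i
    rcases hinr w i hw with h | ⟨p, a, rfl, hp, ha⟩
    · rcases hinr v i hv with h' | ⟨q, b, rfl, hq, hb⟩
      · exact hr (h.trans h'.symm)
      · have := hshort w _ h x hx
        rcases hdouble b v q hb hq x hx with h1 | h1 <;> simp [this] at h1
    · rcases hinr v _ hv with h' | ⟨q, b, hqp, hq, hb⟩
      · have := hshort v _ h' x hx
        rcases hdouble a w p ha hp x hx with h1 | h1 <;> simp [this] at h1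
      · have h1 := hdouble a w p ha hp x hx
        have h2 := hdouble b v q hb hq x (hqp ▸ hx)
        apply hr
        rcases h1 with h1 | h1 <;> rcases h2 with h2 | h2 <;> simp [h1] at h2 <;>
          rw [hp, hq, h2]
  refine exists_injective_option (φ := φ) (fun w v hwv => ?_) fun w w' v p hw hw' hv => ?_
  · rcases hw : φ w with p | i
    · apply hr
      rcases hinl w p hw with h | ⟨h, hno⟩ <;> rcases hinl v p (hwv ▸ hw) with h' | ⟨h', hno'⟩
      · rw [h, h']
      · exact absurd h (hno' w)
      · exact absurd h' (hno v)
      · rw [h, h']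
    · exact huniq w v i hw (hwv ▸ hw)
  -- A pair certifying `p.1.2` has `p.1.2` as its top index, so it is not `p`.
  · have hlow : ∀ x, F x p.1.2 < 0 → r x ≠ .plus p ∧ r x ≠ .minus p := fun x hx => by
      rcases hinr w' _ hw' with h | ⟨q, a, hqp, hq, ha⟩
      · simp [hshort w' _ h x hx]
      · have hne : q ≠ p := by
          rintro rfl
          exact q.2.ne' hqp
        rcases hdouble a w' q ha hq x (hqp ▸ hx) with h1 | h1 <;> simp [h1, hne]
    -- The pair `p` is not occupied by both roots.
    have hnd : ∀ a b, r a = .plus p → r b = .minus p → False := fun a b ha hb => by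
      have h1 := hneg a
      have h2 := hpos' a b _ hb (by simp [ha])
      simp only [ha, PosRoot.val] at h1 h2
      exact (hlow a (by linarith)).1 ha
    have hhigh : ∀ x, F x p.1.1 < 0 → r x ≠ .plus p ∧ r x ≠ .minus p := fun x hx => by
      rcases hinr w _ hw with h | ⟨q, a, hqp, hq, ha⟩
      · simp [hshort w _ h x hx]
      · have hne : q ≠ p := by
          rintro rfl
          exact hnd a w ha hq
        rcases hdouble a w q ha hq x (hqp ▸ hx) with h1 | h1 <;> simp [h1, hne]
    rcases hinl v p hv with h | ⟨h, -⟩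
    · have h1 := hneg v
      simp only [h, PosRoot.val] at h1
      by_cases hx : F v p.1.1 < 0
      · exact (hhigh v hx).1 h
      · exact (hlow v (by linarith)).1 h
    · -- The top coordinate has two disjoint certificates.
      obtain ⟨x, hx⟩ := hcov p.1.1
      have hxv : r x ≠ .minus p := (hhigh x hx).2
      have h1 := hpos' x v _ h hxv.symm
      simp only [PosRoot.val] at h1
      have h2 : F x p.1.2 < 0 := by linarith
      -- `x` is negative at both indices of `p`, so `r x` would have to belong to the certificates
      -- of both.
      rcases hinr w _ hw with h3 | ⟨q, a, hqp, hq, ha⟩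
      · have h4 := hshort w _ h3 x hx
        rcases hinr w' _ hw' with h5 | ⟨q', a', hqp', hq', ha'⟩
        · have := hshort w' _ h5 x h2
          rw [h4] at this
          exact p.2.ne' (by simpa using this)
        · rcases hdouble a' w' q' ha' hq' x (hqp' ▸ h2) with h6 | h6 <;> simp [h4] at h6
      · have h4 := hdouble a w q ha hq x (hqp ▸ hx)
        rcases hinr w' _ hw' with h5 | ⟨q', a', hqp', hq', ha'⟩
        · have := hshort w' _ h5 x h2
          rcases h4 with h4 | h4 <;> simp [this] at h4
        · have h6 := hdouble a' w' q' ha' hq' x (hqp' ▸ h2)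
          have : q = q' := by
            rcases h4 with h4 | h4 <;> rcases h6 with h6 | h6 <;> simp [h4] at h6 <;> exact h6
          rw [← this, hqp] at hqp'
          exact p.2.ne' hqp'

end Combinatorics

end MinInvComplete

open scoped Pointwise

namespace MinInvComplete

/-! ### Inversion sets and private roots -/

section InversionSets

variable {V : Type*} [NormedAddCommGroup V] [InnerProductSpace ℝ V]

theorem isInversionComplete_iff {Φ P : Set V} {Y : Set (weylGroup Φ)} :
    IsInversionComplete Φ P Y ↔ ∀ α ∈ P, ∃ w ∈ Y, α ∈ inversionSet P (w : V ≃ₗᵢ[ℝ] V) := by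
  constructor
  · intro h α hα
    rw [← h] at hα
    simpa using hα
  · intro h
    refine Set.Subset.antisymm (Set.iUnion₂_subset fun w _ => Set.sep_subset _ _) fun α hα => ?_
    simpa using h α hα

/-- Completeness passes to supersets, so minimality need only be tested by deleting single elements;
a root left uncovered then is private to the deleted element. -/
theorem isMinimalInversionComplete_iff {Φ P : Set V} {Y : Set (weylGroup Φ)} :
    IsMinimalInversionComplete Φ P Y ↔ IsInversionComplete Φ P Y ∧
      ∀ w ∈ Y, ∃ α ∈ P, ∀ v ∈ Y, α ∈ inversionSet P (v : V ≃ₗᵢ[ℝ] V) ↔ v = w := by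
  have hmono : ∀ ⦃s t : Set (weylGroup Φ)⦄, IsInversionComplete Φ P t → t ⊆ s →
      IsInversionComplete Φ P s := fun s t ht hts => by
    rw [isInversionComplete_iff] at ht ⊢
    intro α hα
    obtain ⟨w, hw, h⟩ := ht α hα
    exact ⟨w, hts hw, h⟩
  rw [IsMinimalInversionComplete, Set.minimal_iff_forall_sdiff_singleton hmono]
  refine and_congr_right fun hY => forall₂_congr fun w hw => ?_
  rw [isInversionComplete_iff] at hY ⊢
  push Not
  refine exists_congr fun α => and_congr_right fun hα => ⟨fun h v hv => ⟨fun hin => ?_, ?_⟩,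
    fun h v hv hin => hv.2 ((h v hv.1).1 hin)⟩
  · by_contra hne
    exact h v ⟨hv, hne⟩ hin
  · rintro rfl
    obtain ⟨x, hx, hin⟩ := hY α hα
    by_cases hxv : x = v
    · rwa [← hxv]
    · exact absurd hin (h x ⟨hx, hxv⟩)

/-- If `w` permutes the roots, its inversions are the positive roots on which `w γ` is negative. -/
theorem mem_inversionSet_iff {Φ : Set V} {γ α : V} {w : V ≃ₗᵢ[ℝ] V}
    (hneg : ∀ β ∈ Φ, -β ∈ Φ) (hw : ∀ β, w β ∈ Φ ↔ β ∈ Φ) (hα : α ∈ Φ) (hpos : 0 < inner ℝ γ α) :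
    α ∈ inversionSet {β ∈ Φ | 0 < inner ℝ γ β} w ↔ inner ℝ (w γ) α < 0 := by
  have hwα : w (w⁻¹ α) = α := w.apply_symm_apply α
  have h1 : inner ℝ (w γ) α = inner ℝ γ (w⁻¹ α) := by
    conv_lhs => rw [← hwα]
    exact w.inner_map_map _ _
  have h2 : w⁻¹ α ∈ Φ := by rwa [← hw, hwα]
  simp only [inversionSet, Set.mem_ofPred_eq, Set.mem_neg, inner_neg_right, h1]
  exact ⟨fun h => neg_pos.1 h.2.2, fun h => ⟨⟨hα, hpos⟩, hneg _ h2, neg_pos.2 h⟩⟩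

theorem reflection_orthogonal_singleton_eq_self {α v : V} (h : inner ℝ α v = 0) :
    (ℝ ∙ α)ᗮ.reflection v = v :=
  Submodule.reflection_mem_subspace_eq_self
    (Submodule.mem_orthogonal_singleton_iff_inner_right.2 h)

end InversionSets

/-! ### Types B and C via the signed basis -/

section RootSystem

variable {n : ℕ}

/-- The vectors `±ε_i`. -/
def signedBasis (n : ℕ) : Set (EuclideanSpace ℝ (Fin n)) := {v | ∃ i, v = e i ∨ v = -e i}

/-- The roots `±(ε_i ± ε_j)`, `i < j`, and `±k ε_i`. -/
def roots (k : ℝ) (n : ℕ) : Set (EuclideanSpace ℝ (Fin n)) :=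
  {α | ∃ b ∈ signedBasis n, ∃ b' ∈ signedBasis n, inner ℝ b b' = 0 ∧ α = b + b'} ∪
    {α | ∃ b ∈ signedBasis n, α = k • b}

theorem orthonormal_e : Orthonormal ℝ (e : Fin n → EuclideanSpace ℝ (Fin n)) :=
  EuclideanSpace.orthonormal_single

theorem inner_e (i j : Fin n) : inner ℝ (e i) (e j) = if i = j then (1 : ℝ) else 0 :=
  orthonormal_iff_ite.1 orthonormal_e i j

theorem rootsD_eq (n : ℕ) : rootsD n =
    {α | ∃ b ∈ signedBasis n, ∃ b' ∈ signedBasis n, inner ℝ b b' = 0 ∧ α = b + b'} := by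
  ext α
  constructor
  · rintro ⟨i, j, hij, h⟩
    have h0 : inner ℝ (e i) (e j) = (0 : ℝ) := by simp [inner_e, hij.ne]
    rcases h with rfl | rfl | rfl | rfl
    · exact ⟨e i, ⟨i, .inl rfl⟩, e j, ⟨j, .inl rfl⟩, by simp [h0], rfl⟩
    · exact ⟨e i, ⟨i, .inl rfl⟩, -e j, ⟨j, .inr rfl⟩, by simp [h0], by abel⟩
    · exact ⟨-e i, ⟨i, .inr rfl⟩, -e j, ⟨j, .inr rfl⟩, by simp [h0], by abel⟩
    · exact ⟨-e i, ⟨i, .inr rfl⟩, e j, ⟨j, .inl rfl⟩, by simp [h0], by abel⟩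
  · rintro ⟨b, ⟨i, hb⟩, b', ⟨j, hb'⟩, h0, rfl⟩
    have hij : i ≠ j := by
      rintro rfl
      have h1 := inner_e i i
      rcases hb with rfl | rfl <;> rcases hb' with rfl | rfl <;>
        simp only [inner_neg_left, inner_neg_right, h1] at h0 <;> norm_num at h0
    rcases lt_or_gt_of_ne hij with h | h
    · refine ⟨i, j, h, ?_⟩
      rcases hb with rfl | rfl <;> rcases hb' with rfl | rfl
      · exact .inl rfl
      · exact .inr (.inl (by abel))
      · exact .inr (.inr (.inr (by abel)))
      · exact .inr (.inr (.inl (by abel)))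
    · refine ⟨j, i, h, ?_⟩
      rcases hb with rfl | rfl <;> rcases hb' with rfl | rfl
      · exact .inl (by abel)
      · exact .inr (.inr (.inr (by abel)))
      · exact .inr (.inl (by abel))
      · exact .inr (.inr (.inl (by abel)))

theorem rootsB_eq (n : ℕ) : rootsB n = roots 1 n := by
  simp [rootsB, roots, rootsD_eq, signedBasis]

theorem rootsC_eq (n : ℕ) : rootsC n = roots 2 n := by
  rw [rootsC, roots, rootsD_eq]
  congr 1
  ext α
  constructor
  · rintro ⟨i, rfl | rfl⟩
    · exact ⟨e i, ⟨i, .inl rfl⟩, rfl⟩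
    · exact ⟨-e i, ⟨i, .inr rfl⟩, (smul_neg _ _).symm⟩
  · rintro ⟨b, ⟨i, rfl | rfl⟩, rfl⟩
    · exact ⟨i, .inl rfl⟩
    · exact ⟨i, .inr (smul_neg _ _)⟩

theorem neg_mem_signedBasis {b : EuclideanSpace ℝ (Fin n)} (hb : b ∈ signedBasis n) :
    -b ∈ signedBasis n := by
  obtain ⟨i, rfl | rfl⟩ := hb
  · exact ⟨i, .inr rfl⟩
  · exact ⟨i, .inl (neg_neg _)⟩

theorem norm_of_mem_signedBasis {b : EuclideanSpace ℝ (Fin n)} (hb : b ∈ signedBasis n) :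
    ‖b‖ = 1 := by
  obtain ⟨i, rfl | rfl⟩ := hb
  · exact orthonormal_e.1 i
  · rw [norm_neg]
    exact orthonormal_e.1 i

theorem signedBasis_trichotomy {b v : EuclideanSpace ℝ (Fin n)} (hb : b ∈ signedBasis n)
    (hv : v ∈ signedBasis n) : v = b ∨ v = -b ∨ inner ℝ b v = 0 := by
  obtain ⟨i, hb⟩ := hb
  obtain ⟨j, hv⟩ := hv
  by_cases hij : i = j
  · subst hij
    rcases hb with rfl | rfl <;> rcases hv with rfl | rfl <;> simp
  · right; right
    rcases hb with rfl | rfl <;> rcases hv with rfl | rfl <;> simp [inner_e, hij]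

theorem neg_mem_roots {k : ℝ} {α : EuclideanSpace ℝ (Fin n)} (h : α ∈ roots k n) :
    -α ∈ roots k n := by
  rcases h with ⟨b, hb, b', hb', h0, rfl⟩ | ⟨b, hb, rfl⟩
  · exact .inl ⟨-b, neg_mem_signedBasis hb, -b', neg_mem_signedBasis hb', by simpa using h0,
      neg_add _ _⟩
  · exact .inr ⟨-b, neg_mem_signedBasis hb, (smul_neg _ _).symm⟩

/-- The reflection in `b - b'` exchanges the orthogonal vectors `b`, `b'` of the signed basis. -/
theorem reflection_sub_apply {b b' : EuclideanSpace ℝ (Fin n)} (hb : b ∈ signedBasis n)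
    (hb' : b' ∈ signedBasis n) :
    (ℝ ∙ (b - b'))ᗮ.reflection b = b' ∧ (ℝ ∙ (b - b'))ᗮ.reflection b' = b := by
  have h : ‖b‖ = ‖b'‖ := by rw [norm_of_mem_signedBasis hb, norm_of_mem_signedBasis hb']
  have h1 := Submodule.reflection_sub h
  have h2 := Submodule.reflection_reflection (ℝ ∙ (b - b'))ᗮ b
  rw [h1] at h2
  exact ⟨h1, h2⟩

theorem reflection_smul_apply {k : ℝ} (hk : k ≠ 0) (b : EuclideanSpace ℝ (Fin n)) :
    (ℝ ∙ (k • b))ᗮ.reflection b = -b := by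
  have h := Submodule.reflection_orthogonalComplement_singleton_eq_neg (𝕜 := ℝ) (k • b)
  rw [map_smul, ← smul_neg] at h
  exact smul_right_injective _ hk h

theorem reflection_mem_signedBasis {k : ℝ} (hk : k ≠ 0) {α v : EuclideanSpace ℝ (Fin n)}
    (hα : α ∈ roots k n) (hv : v ∈ signedBasis n) :
    (ℝ ∙ α)ᗮ.reflection v ∈ signedBasis n := by
  rcases hα with ⟨b, hb, b', hb', h0, rfl⟩ | ⟨b, hb, rfl⟩
  -- Since b + b' = b - (-b'), its reflection exchanges b and -b'.
  · have h := reflection_sub_apply hb (neg_mem_signedBasis hb')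
    simp only [sub_neg_eq_add, map_neg, neg_eq_iff_eq_neg] at h
    rcases signedBasis_trichotomy hb hv with rfl | rfl | h1
    · rw [h.1]
      exact neg_mem_signedBasis hb'
    · rw [map_neg, h.1, neg_neg]
      exact hb'
    · rcases signedBasis_trichotomy hb' hv with rfl | rfl | h2
      · rw [h.2]
        exact neg_mem_signedBasis hb
      · rw [map_neg, h.2, neg_neg]
        exact hb
      · rwa [reflection_orthogonal_singleton_eq_self]
        rw [inner_add_left, h1, h2, add_zero]
  · rcases signedBasis_trichotomy hb hv with rfl | rfl | h1
    · rw [reflection_smul_apply hk]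
      exact neg_mem_signedBasis hv
    · rw [map_neg, reflection_smul_apply hk, neg_neg]
      exact hb
    · rwa [reflection_orthogonal_singleton_eq_self]
      rw [inner_smul_left, h1, mul_zero]

/-- Roots are built from the signed basis by linear operations and orthogonality, so stability of
the roots reduces to this. The equivalence lets the induction pass to inverses. -/
theorem weylGroup_mem_signedBasis_iff {k : ℝ} (hk : k ≠ 0)
    {w : EuclideanSpace ℝ (Fin n) ≃ₗᵢ[ℝ] EuclideanSpace ℝ (Fin n)}
    (hw : w ∈ weylGroup (roots k n)) (v : EuclideanSpace ℝ (Fin n)) :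
    w v ∈ signedBasis n ↔ v ∈ signedBasis n := by
  induction hw using Subgroup.closure_induction generalizing v with
  | mem s hs =>
    obtain ⟨α, hα, rfl⟩ := hs
    refine ⟨fun h => ?_, reflection_mem_signedBasis hk hα⟩
    have := reflection_mem_signedBasis hk hα h
    rwa [Submodule.reflection_reflection] at this
  | one => rfl
  | mul x y _ _ hx hy => exact (hx _).trans (hy v)
  | inv x _ hx =>
    rw [← hx]
    exact (congrArg (· ∈ signedBasis n) (x.apply_symm_apply v)).to_iff

theorem weylGroup_apply_mem_roots {k : ℝ} (hk : k ≠ 0)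
    {w : EuclideanSpace ℝ (Fin n) ≃ₗᵢ[ℝ] EuclideanSpace ℝ (Fin n)}
    (hw : w ∈ weylGroup (roots k n)) {α : EuclideanSpace ℝ (Fin n)} (hα : α ∈ roots k n) :
    w α ∈ roots k n := by
  rcases hα with ⟨b, hb, b', hb', h0, rfl⟩ | ⟨b, hb, rfl⟩
  · exact .inl ⟨w b, (weylGroup_mem_signedBasis_iff hk hw b).2 hb, w b',
      (weylGroup_mem_signedBasis_iff hk hw b').2 hb', by rwa [w.inner_map_map], map_add _ _ _⟩
  · exact .inr ⟨w b, (weylGroup_mem_signedBasis_iff hk hw b).2 hb, map_smul _ _ _⟩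

theorem weylGroup_mem_roots_iff {k : ℝ} (hk : k ≠ 0)
    {w : EuclideanSpace ℝ (Fin n) ≃ₗᵢ[ℝ] EuclideanSpace ℝ (Fin n)}
    (hw : w ∈ weylGroup (roots k n)) (α : EuclideanSpace ℝ (Fin n)) :
    w α ∈ roots k n ↔ α ∈ roots k n := by
  refine ⟨fun h => ?_, weylGroup_apply_mem_roots hk hw⟩
  have := weylGroup_apply_mem_roots hk (inv_mem hw) h
  rwa [show w⁻¹ (w α) = α from w.symm_apply_apply α] at this

/-! ### Adapted bases and labels of positive roots -/

/-- A signed orthonormal basis `u` in which the coordinates of `γ` are positive and strictly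
increasing. -/
structure Adapted (γ : EuclideanSpace ℝ (Fin n)) (u : Fin n → EuclideanSpace ℝ (Fin n)) :
    Prop where
  orthonormal : Orthonormal ℝ u
  mem_iff : ∀ v, v ∈ signedBasis n ↔ ∃ i, v = u i ∨ v = -u i
  pos : ∀ i, 0 < inner ℝ γ (u i)
  strictMono : StrictMono fun i => (inner ℝ γ (u i) : ℝ)

theorem exists_adapted {k : ℝ} {γ : EuclideanSpace ℝ (Fin n)}
    (hγ : ∀ α ∈ roots k n, inner ℝ γ α ≠ (0 : ℝ)) : ∃ u, Adapted γ u := by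
  have h1 : ∀ i, ∃ b, (b = e i ∨ b = -e i) ∧ 0 < (inner ℝ γ b : ℝ) := fun i => by
    have hne : inner ℝ γ (e i) ≠ (0 : ℝ) := fun h0 =>
      hγ (k • e i) (.inr ⟨e i, ⟨i, .inl rfl⟩, rfl⟩) (by rw [inner_smul_right, h0, mul_zero])
    rcases lt_or_gt_of_ne hne with h | h
    · exact ⟨-e i, .inr rfl, by rw [inner_neg_right]; exact neg_pos.2 h⟩
    · exact ⟨e i, .inl rfl, h⟩
  choose b hb hpos using h1
  have hmem : ∀ i, b i ∈ signedBasis n := fun i => ⟨i, hb i⟩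
  have horth : ∀ i j, i ≠ j → inner ℝ (b i) (b j) = (0 : ℝ) := fun i j hij => by
    rcases hb i with h | h <;> rcases hb j with h' | h' <;> simp [h, h', inner_e, hij]
  let c : Fin n → ℝ := fun i => inner ℝ γ (b i)
  -- Equal coordinates would make γ orthogonal to the root b_i - b_j.
  have hinj : Function.Injective c := fun i j hij => by
    by_contra hne
    refine hγ (b i + -b j) (.inl ⟨b i, hmem i, -b j, neg_mem_signedBasis (hmem j), ?_, rfl⟩) ?_
    · rw [inner_neg_right, horth i j hne, neg_zero]
    · rw [inner_add_right, inner_neg_right]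
      exact sub_eq_zero.2 hij
  refine ⟨fun i => b (Tuple.sort c i), ⟨fun i => norm_of_mem_signedBasis (hmem _),
    fun i j hij => horth _ _ ((Tuple.sort c).injective.ne hij)⟩, fun v => ?_,
    fun i => hpos _, (Tuple.monotone_sort c).strictMono_of_injective
      (hinj.comp (Tuple.sort c).injective)⟩
  constructor
  · rintro ⟨i, hv⟩
    refine ⟨(Tuple.sort c).symm i, ?_⟩
    simp only [Equiv.apply_symm_apply]
    rcases hb i with h | h <;> rcases hv with rfl | rfl <;> simp [h]
  · rintro ⟨i, rfl | rfl⟩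
    · exact hmem _
    · exact neg_mem_signedBasis (hmem _)

/-- The positive root with a given label. -/
def PosRoot.toVec (k : ℝ) (u : Fin n → EuclideanSpace ℝ (Fin n)) :
    PosRoot n → EuclideanSpace ℝ (Fin n)
  | .short i => k • u i
  | .plus p => u p.1.1 + u p.1.2
  | .minus p => u p.1.1 - u p.1.2

theorem PosRoot.inner_toVec_pos_iff {k : ℝ} (hk : 0 < k) (u : Fin n → EuclideanSpace ℝ (Fin n))
    (y : EuclideanSpace ℝ (Fin n)) (ρ : PosRoot n) :
    0 < (inner ℝ y (ρ.toVec k u) : ℝ) ↔ 0 < ρ.val fun i => inner ℝ y (u i) := by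
  cases ρ with
  | short i => simp [toVec, val, inner_smul_right, hk]
  | plus p => simp [toVec, val, inner_add_right]
  | minus p => simp [toVec, val, inner_sub_right]

theorem PosRoot.inner_toVec_neg_iff {k : ℝ} (hk : 0 < k) (u : Fin n → EuclideanSpace ℝ (Fin n))
    (y : EuclideanSpace ℝ (Fin n)) (ρ : PosRoot n) :
    (inner ℝ y (ρ.toVec k u) : ℝ) < 0 ↔ (ρ.val fun i => inner ℝ y (u i)) < 0 := by
  cases ρ with
  | short i => simp [toVec, val, inner_smul_right, mul_neg_iff, hk, hk.not_gt]
  | plus p => simp [toVec, val, inner_add_right]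
  | minus p => simp [toVec, val, inner_sub_right]

namespace Adapted

variable {γ : EuclideanSpace ℝ (Fin n)} {u : Fin n → EuclideanSpace ℝ (Fin n)}

theorem mem (hu : Adapted γ u) (i : Fin n) : u i ∈ signedBasis n :=
  (hu.mem_iff _).2 ⟨i, .inl rfl⟩

theorem toVec_mem (hu : Adapted γ u) (k : ℝ) (ρ : PosRoot n) : ρ.toVec k u ∈ roots k n := by
  cases ρ with
  | short i => exact .inr ⟨u i, hu.mem i, rfl⟩
  | plus p => exact .inl ⟨_, hu.mem _, _, hu.mem _, hu.orthonormal.2 p.2.ne', rfl⟩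
  | minus p =>
    exact .inl ⟨_, hu.mem _, _, neg_mem_signedBasis (hu.mem _),
      by rw [inner_neg_right, hu.orthonormal.2 p.2.ne', neg_zero], sub_eq_add_neg _ _⟩

theorem toVec_pos (hu : Adapted γ u) {k : ℝ} (hk : 0 < k) (ρ : PosRoot n) :
    0 < (inner ℝ γ (ρ.toVec k u) : ℝ) := by
  rw [PosRoot.inner_toVec_pos_iff hk]
  cases ρ with
  | short i => exact hu.pos i
  | plus p => exact add_pos (hu.pos _) (hu.pos _)
  | minus p => exact sub_pos.2 (hu.strictMono p.2)

theorem exists_toVec (hu : Adapted γ u) {k : ℝ} (hk : 0 < k) {α : EuclideanSpace ℝ (Fin n)}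
    (hα : α ∈ roots k n) (hpos : 0 < (inner ℝ γ α : ℝ)) : ∃ ρ : PosRoot n, ρ.toVec k u = α := by
  rcases hα with ⟨b, hb, b', hb', h0, rfl⟩ | ⟨b, hb, rfl⟩
  · obtain ⟨i, hb⟩ := (hu.mem_iff b).1 hb
    obtain ⟨j, hb'⟩ := (hu.mem_iff b').1 hb'
    have hij : i ≠ j := by
      rintro rfl
      have h1 : inner ℝ (u i) (u i) = (1 : ℝ) := by simp [hu.orthonormal.1 i]
      rcases hb with rfl | rfl <;> rcases hb' with rfl | rfl <;>
        simp only [inner_neg_left, inner_neg_right, h1] at h0 <;> norm_num at h0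
    have hi := hu.pos i
    have hj := hu.pos j
    rw [inner_add_right] at hpos
    rcases lt_or_gt_of_ne hij with h | h <;> have hlt := hu.strictMono h <;>
      simp only at hlt <;>
      rcases hb with rfl | rfl <;> rcases hb' with rfl | rfl <;>
      try simp only [inner_neg_right] at hpos
    · exact ⟨.plus ⟨(j, i), h⟩, add_comm _ _⟩
    · linarith
    · exact ⟨.minus ⟨(j, i), h⟩, sub_eq_neg_add _ _⟩
    · linarith
    · exact ⟨.plus ⟨(i, j), h⟩, rfl⟩
    · exact ⟨.minus ⟨(i, j), h⟩, sub_eq_add_neg _ _⟩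
    · linarith
    · linarith
  · obtain ⟨i, rfl | rfl⟩ := (hu.mem_iff b).1 hb
    · exact ⟨.short i, rfl⟩
    · rw [inner_smul_right, inner_neg_right] at hpos
      nlinarith [hu.pos i, mul_pos hk (hu.pos i)]

theorem mem_inversionSet_iff (hu : Adapted γ u) {k : ℝ} (hk : 0 < k)
    (w : weylGroup (roots k n)) (ρ : PosRoot n) :
    ρ.toVec k u ∈ inversionSet {α ∈ roots k n | 0 < inner ℝ γ α}
        (w : EuclideanSpace ℝ (Fin n) ≃ₗᵢ[ℝ] EuclideanSpace ℝ (Fin n)) ↔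
      (ρ.val fun i => inner ℝ (w.1 γ) (u i)) < 0 := by
  rw [← PosRoot.inner_toVec_neg_iff hk]
  exact MinInvComplete.mem_inversionSet_iff (fun _ => neg_mem_roots)
    (weylGroup_mem_roots_iff hk.ne' w.2) (hu.toVec_mem k ρ) (hu.toVec_pos hk ρ)

/-! ### Weyl group elements with prescribed inversions -/

/-- The swap of `u i` and `u j` belongs to the Weyl group. -/
theorem exists_swap (hu : Adapted γ u) (k : ℝ) (i j : Fin n) :
    ∃ w ∈ weylGroup (roots k n), ∀ m, w (u m) = u (Equiv.swap i j m) := by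
  by_cases hij : i = j
  · subst hij
    exact ⟨1, one_mem _, fun m => by simp⟩
  · refine ⟨_, Subgroup.subset_closure ⟨u i - u j, .inl ⟨u i, hu.mem i, -u j,
      neg_mem_signedBasis (hu.mem j), ?_, sub_eq_add_neg _ _⟩, rfl⟩, fun m => ?_⟩
    · rw [inner_neg_right, hu.orthonormal.2 hij, neg_zero]
    · have h := reflection_sub_apply (hu.mem i) (hu.mem j)
      by_cases hi : m = i
      · rw [hi, h.1, Equiv.swap_apply_left]
      by_cases hj : m = j
      · rw [hj, h.2, Equiv.swap_apply_right]
      rw [Equiv.swap_apply_of_ne_of_ne hi hj, reflection_orthogonal_singleton_eq_self]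
      rw [inner_sub_left, hu.orthonormal.2 (Ne.symm hi), hu.orthonormal.2 (Ne.symm hj), sub_zero]

/-- The sign change of `u j` belongs to the Weyl group. -/
theorem exists_flip (hu : Adapted γ u) {k : ℝ} (hk : k ≠ 0) (j : Fin n) :
    ∃ w ∈ weylGroup (roots k n), w (u j) = -u j ∧ ∀ m, m ≠ j → w (u m) = u m := by
  refine ⟨_, Subgroup.subset_closure ⟨k • u j, .inr ⟨u j, hu.mem j, rfl⟩, rfl⟩, ?_,
    fun m hm => ?_⟩
  · exact reflection_smul_apply hk _
  · rw [reflection_orthogonal_singleton_eq_self]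
    rw [inner_smul_left, hu.orthonormal.2 hm.symm, mul_zero]

/-- Give the lower index of `p` the smallest coordinate of γ, the top index minus the second
smallest, and the other indices the larger ones. The only negative coordinate is then outweighed by
every other except its partner. -/
theorem exists_weyl_pair (hu : Adapted γ u) {k : ℝ} (hk : k ≠ 0) (p : Pairs n) :
    ∃ w : weylGroup (roots k n), ∃ y : Fin n → ℝ, (fun i => inner ℝ (w.1 γ) (u i)) = y ∧
      0 < y p.1.2 ∧ y p.1.1 + y p.1.2 < 0 ∧
      ∀ m, m ≠ p.1.1 → m ≠ p.1.2 → 0 < y m ∧ 0 < y p.1.1 + y m := by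
  obtain ⟨⟨j, i⟩, hij⟩ := p
  simp only at hij
  have hn : 1 < n := by have := j.2; have : i.1 < j.1 := hij; omega
  let z : Fin n := ⟨0, by omega⟩
  let o : Fin n := ⟨1, hn⟩
  have hzo : z < o := by simp [z, o, Fin.lt_def]
  obtain ⟨f, hf, hfj, hfm⟩ := hu.exists_flip hk j
  obtain ⟨s, hs, hsm⟩ := hu.exists_swap k i z
  -- The first swap may have moved `j`, so the second starts from its image; that image is not `z`,
  -- hence `i ↦ z` survives.
  obtain ⟨t, ht, htm⟩ := hu.exists_swap k (Equiv.swap i z j) o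
  let π : Equiv.Perm (Fin n) := (Equiv.swap i z).trans (Equiv.swap (Equiv.swap i z j) o)
  have hπj : π j = o := by simp [π]
  have hπi : π i = z := by
    simp only [π, Equiv.trans_apply, Equiv.swap_apply_left]
    refine Equiv.swap_apply_of_ne_of_ne (fun h => hij.ne ?_) hzo.ne
    exact (Equiv.swap i z).injective ((Equiv.swap_apply_left i z).trans h)
  have hg : t * s * f ∈ weylGroup (roots k n) := mul_mem (mul_mem ht hs) hf
  have hval : ∀ m, inner ℝ ((t * s * f)⁻¹ γ) (u m) = (inner ℝ γ ((t * s * f) (u m)) : ℝ) :=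
    fun m => by
      rw [← (t * s * f).inner_map_map]
      exact congrArg (fun x => inner ℝ x _) ((t * s * f).apply_symm_apply γ)
  have hts : ∀ m, t (s (u m)) = u (π m) := fun m => by rw [hsm, htm]; rfl
  have hj : (t * s * f) (u j) = -u o := by
    change t (s (f (u j))) = _
    rw [hfj, map_neg, map_neg, hts, hπj]
  have hm : ∀ m, m ≠ j → (t * s * f) (u m) = u (π m) := fun m hm => by
    change t (s (f (u m))) = _
    rw [hfm m hm, hts]
  refine ⟨⟨(t * s * f)⁻¹, inv_mem hg⟩, _, rfl, ?_, ?_, fun m hmj hmi => ?_⟩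
  · simp only [hval]
    rw [hm i hij.ne]
    exact hu.pos _
  · simp only [hval]
    rw [hm i hij.ne, hj, hπi, inner_neg_right]
    have := hu.strictMono hzo
    simp only at this
    linarith
  · simp only [hval] at *
    simp only [ne_eq] at hmj hmi
    rw [hm m hmj, hj, inner_neg_right]
    refine ⟨hu.pos _, ?_⟩
    have h1 : π m ≠ z := fun h => hmi (π.injective (h.trans hπi.symm))
    have h2 : π m ≠ o := fun h => hmj (π.injective (h.trans hπj.symm))
    have h3 : o < π m := by
      simp only [z, o, ne_eq, Fin.ext_iff, Fin.lt_def] at *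
      omega
    have := hu.strictMono h3
    simp only at this
    linarith

theorem exists_weyl_zero (hu : Adapted γ u) {k : ℝ} (hk : k ≠ 0) (z : Fin n) (hz : ∀ m, z ≤ m) :
    ∃ w : weylGroup (roots k n), ∃ y : Fin n → ℝ, (fun i => inner ℝ (w.1 γ) (u i)) = y ∧
      y z < 0 ∧ ∀ m, m ≠ z → 0 < y m ∧ 0 < y m + y z := by
  obtain ⟨f, hf, hfz, hfm⟩ := hu.exists_flip hk z
  have hval : ∀ m, inner ℝ (f⁻¹ γ) (u m) = (inner ℝ γ (f (u m)) : ℝ) := fun m => by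
    rw [← f.inner_map_map]
    exact congrArg (fun x => inner ℝ x _) (f.apply_symm_apply γ)
  refine ⟨⟨f⁻¹, inv_mem hf⟩, _, rfl, ?_, fun m hm => ?_⟩
  · simp only [hval]
    rw [hfz, inner_neg_right]
    exact neg_neg_of_pos (hu.pos z)
  · simp only [hval]
    rw [hfz, hfm m hm, inner_neg_right]
    have := hu.strictMono (lt_of_le_of_ne (hz m) hm.symm)
    simp only at this
    exact ⟨hu.pos m, by linarith⟩

theorem isMinimalInversionComplete_iff (hu : Adapted γ u) {k : ℝ} (hk : 0 < k)
    {Y : Set (weylGroup (roots k n))} :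
    IsMinimalInversionComplete (roots k n) {α ∈ roots k n | 0 < inner ℝ γ α} Y ↔
      (∀ ρ : PosRoot n, ∃ w ∈ Y, (ρ.val fun i => inner ℝ (w.1 γ) (u i)) < 0) ∧
      ∀ w ∈ Y, ∃ ρ : PosRoot n, ∀ v ∈ Y, (ρ.val fun i => inner ℝ (v.1 γ) (u i)) < 0 ↔ v = w := by
  have hP : ∀ ρ : PosRoot n, ρ.toVec k u ∈ {α ∈ roots k n | 0 < inner ℝ γ α} := fun ρ =>
    ⟨hu.toVec_mem k ρ, hu.toVec_pos hk ρ⟩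
  rw [MinInvComplete.isMinimalInversionComplete_iff, isInversionComplete_iff]
  simp only [← hu.mem_inversionSet_iff hk]
  constructor
  · rintro ⟨h1, h2⟩
    refine ⟨fun ρ => h1 _ (hP ρ), fun w hw => ?_⟩
    obtain ⟨α, hα, h⟩ := h2 w hw
    obtain ⟨ρ, rfl⟩ := hu.exists_toVec hk hα.1 hα.2
    exact ⟨ρ, h⟩
  · rintro ⟨h1, h2⟩
    refine ⟨fun α hα => ?_, fun w hw => ?_⟩
    · obtain ⟨ρ, rfl⟩ := hu.exists_toVec hk hα.1 hα.2
      exact h1 ρ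
    · obtain ⟨ρ, h⟩ := h2 w hw
      exact ⟨_, hP ρ, h⟩

/-- Regularity of wγ upgrades "not inverted" to the strict positivity that
`exists_injective_of_private` needs. -/
theorem val_ne_zero (hu : Adapted γ u) {k : ℝ} (hk : 0 < k)
    (hγ : ∀ α ∈ roots k n, inner ℝ γ α ≠ (0 : ℝ)) (w : weylGroup (roots k n)) (ρ : PosRoot n) :
    (ρ.val fun i => inner ℝ (w.1 γ) (u i)) ≠ 0 := by
  have h1 : inner ℝ (w.1 γ) (ρ.toVec k u) ≠ (0 : ℝ) := by
    rw [← w.1.apply_symm_apply (ρ.toVec k u), w.1.inner_map_map]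
    exact hγ _ (weylGroup_apply_mem_roots hk.ne' (inv_mem w.2) (hu.toVec_mem k ρ))
  rcases lt_or_gt_of_ne h1 with h | h
  · exact ((PosRoot.inner_toVec_neg_iff hk u _ ρ).1 h).ne
  · exact ((PosRoot.inner_toVec_pos_iff hk u _ ρ).1 h).ne'

end Adapted

/-! ### The two bounds -/

theorem card_option_pairs (n : ℕ) :
    ENat.card (Option (Pairs n)) = ((n.choose 2 + 1 : ℕ) : ℕ∞) := by
  rw [ENat.card_eq_coe_fintype_card, Fintype.card_option, card_pairs]

theorem encard_le_of_isMinimalInversionComplete {k : ℝ} (hk : 0 < k)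
    {γ : EuclideanSpace ℝ (Fin n)} (hγ : ∀ α ∈ roots k n, inner ℝ γ α ≠ (0 : ℝ))
    {Y : Set (weylGroup (roots k n))}
    (hY : IsMinimalInversionComplete (roots k n) {α ∈ roots k n | 0 < inner ℝ γ α} Y) :
    Y.encard ≤ (n.choose 2 + 1 : ℕ) := by
  obtain ⟨u, hu⟩ := exists_adapted hγ
  obtain ⟨hcov, hpriv⟩ := (hu.isMinimalInversionComplete_iff hk).1 hY
  choose r hr using fun w : Y => hpriv w.1 w.2
  obtain ⟨ψ, hψ⟩ := exists_injective_of_private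
    (fun (w : Y) i => (inner ℝ (w.1.1 γ) (u i) : ℝ)) r (fun w => (hr w w.1 w.2).2 rfl)
    (fun w v hwv => lt_of_le_of_ne
      (not_lt.1 fun h => hwv (Subtype.ext ((hr v w.1 w.2).1 h)))
      (hu.val_ne_zero hk hγ _ _).symm)
    (fun i => by
      obtain ⟨w, hw, h⟩ := hcov (.short i)
      exact ⟨⟨w, hw⟩, h⟩)
  rw [← card_option_pairs]
  exact ENat.card_le_card_of_injective hψ

theorem exists_isMinimalInversionComplete {k : ℝ} (hk : 0 < k) (hn : 1 ≤ n)
    {γ : EuclideanSpace ℝ (Fin n)} (hγ : ∀ α ∈ roots k n, inner ℝ γ α ≠ (0 : ℝ)) :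
    ∃ Y : Set (weylGroup (roots k n)),
      IsMinimalInversionComplete (roots k n) {α ∈ roots k n | 0 < inner ℝ γ α} Y ∧
      Y.encard = (n.choose 2 + 1 : ℕ) := by
  obtain ⟨u, hu⟩ := exists_adapted hγ
  let z : Fin n := ⟨0, hn⟩
  have hz : ∀ m, z ≤ m := fun m => Nat.zero_le _
  obtain ⟨w₀, y₀, hy₀, hneg₀, hpos₀⟩ := hu.exists_weyl_zero hk.ne' z hz
  choose w y hy hpos hneg hrest using hu.exists_weyl_pair hk.ne'
  let g : Option (Pairs n) → weylGroup (roots k n) := fun a => a.elim w₀ w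
  let r : Option (Pairs n) → PosRoot n := fun a => a.elim (.short z) .plus
  have hself : ∀ a, ((r a).val fun i => inner ℝ ((g a).1 γ) (u i)) < 0 := fun a => by
    cases a with
    | none => exact (congrArg (PosRoot.val · (.short z)) hy₀).trans_lt hneg₀
    | some p => exact (congrArg (PosRoot.val · (.plus p)) (hy p)).trans_lt (hneg p)
  have hother : ∀ a b, a ≠ b → 0 < ((r b).val fun i => inner ℝ ((g a).1 γ) (u i)) :=
    fun a b hab => by
      have hG : (fun i => inner ℝ ((g a).1 γ) (u i)) = a.elim y₀ y := by
        cases a with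
        | none => exact hy₀
        | some p => exact hy p
      rw [hG]
      rcases a with _ | p <;> rcases b with _ | q
      · exact absurd rfl hab
      · simp only [r, Option.elim, PosRoot.val]
        have h1 := hpos₀ q.1.1 ((hz _).trans_lt q.2).ne'
        by_cases h : q.1.2 = z
        · rw [h]
          exact h1.2
        · exact add_pos h1.1 (hpos₀ _ h).1
      · simp only [r, Option.elim, PosRoot.val]
        by_cases h : z = p.1.2
        · rw [h]
          exact hpos p
        · exact (hrest p z ((hz _).trans_lt p.2).ne h).1
      · have hne : p ≠ q := fun h => hab (by rw [h])
        simp only [r, Option.elim, PosRoot.val]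
        have hall : ∀ m, m ≠ p.1.1 → 0 < y p m := fun m hm => by
          by_cases h : m = p.1.2
          · rw [h]
            exact hpos p
          · exact (hrest p m hm h).1
        -- Only the coordinate at `p.1.1` is negative, so the sum is in doubt only if `q` contains
        -- that index; its other index is then not `p.1.2`.
        by_cases h1 : q.1.1 = p.1.1
        · have h2 : q.1.2 ≠ p.1.2 := fun h2 => hne (Subtype.ext (Prod.ext h1.symm h2.symm))
          have h3 : q.1.2 ≠ p.1.1 := fun h3 => (h1 ▸ h3 ▸ q.2).false
          rw [h1]
          exact (hrest p _ h3 h2).2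
        · by_cases h2 : q.1.2 = p.1.1
          · have h3 : q.1.1 ≠ p.1.2 := fun h3 => by
              have h4 := q.2
              rw [h2, h3] at h4
              exact h4.not_gt p.2
            rw [h2, add_comm]
            exact (hrest p _ h1 h3).2
          · exact add_pos (hall _ h1) (hall _ h2)
  have hg : Function.Injective g := fun a b hab => by
    by_contra hne
    have h1 := hother a b hne
    rw [hab] at h1
    exact (h1.trans (hself b)).false
  refine ⟨Set.range g, (hu.isMinimalInversionComplete_iff hk).2 ⟨fun ρ => ?_, ?_⟩, ?_⟩
  · rw [Set.exists_range_iff]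
    cases ρ with
    | short i =>
      by_cases hi : i = z
      · subst hi
        exact ⟨none, hself none⟩
      -- For the pair `(i, z)`, y_i + y_z < 0 < y_z forces y_i < 0.
      · refine ⟨some ⟨(i, z), lt_of_le_of_ne (hz i) (Ne.symm hi)⟩, ?_⟩
        simp only [g, Option.elim]
        rw [hy, PosRoot.val]
        have h1 := hneg ⟨(i, z), lt_of_le_of_ne (hz i) (Ne.symm hi)⟩
        have h2 := hpos ⟨(i, z), lt_of_le_of_ne (hz i) (Ne.symm hi)⟩
        simp only at h1 h2
        linarith
    | plus p => exact ⟨some p, hself (some p)⟩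
    | minus p =>
      refine ⟨some p, ?_⟩
      simp only [g, Option.elim]
      rw [hy, PosRoot.val]
      linarith [hneg p, hpos p]
  · rintro _ ⟨a, rfl⟩
    refine ⟨r a, ?_⟩
    rintro _ ⟨b, rfl⟩
    refine ⟨fun h => ?_, fun h => ?_⟩
    · by_contra hne
      exact (h.trans (hother b a fun hba => hne (by rw [hba]))).false
    · rw [hg h]
      exact hself a
  · rw [← card_option_pairs, ← Set.image_univ, hg.encard_image, Set.encard_univ]

theorem isMC_roots {k : ℝ} (hk : 0 < k) (hn : 1 ≤ n) {P : Set (EuclideanSpace ℝ (Fin n))}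
    (hP : IsPositiveSystem (roots k n) P) : IsMC (roots k n) P (n.choose 2 + 1) := by
  obtain ⟨γ, hγ, rfl⟩ := hP
  refine ⟨exists_isMinimalInversionComplete hk hn hγ, ?_⟩
  rintro _ ⟨Y, hY, rfl⟩
  exact encard_le_of_isMinimalInversionComplete hk hγ hY

end RootSystem

end MinInvComplete

theorem mainTheorem2 (n : ℕ) (hn : 1 ≤ n) :
    (∀ P : Set (EuclideanSpace ℝ (Fin n)),
      MinInvComplete.IsPositiveSystem (MinInvComplete.rootsB n) P →
        MinInvComplete.IsMC (MinInvComplete.rootsB n) P (n.choose 2 + 1)) ∧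
    (∀ P : Set (EuclideanSpace ℝ (Fin n)),
      MinInvComplete.IsPositiveSystem (MinInvComplete.rootsC n) P →
        MinInvComplete.IsMC (MinInvComplete.rootsC n) P (n.choose 2 + 1)) := by
  rw [MinInvComplete.rootsB_eq, MinInvComplete.rootsC_eq]
  exact ⟨fun _ => MinInvComplete.isMC_roots one_pos hn,
    fun _ => MinInvComplete.isMC_roots two_pos hn⟩
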